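/- Let $G$ be a finite simple connected graph of order $n$ with minimum degree $\delta\ge k\ge 2$ and girth $g\ge 3$ (the length of a shortest cycle), and put $t=\lfloor (g-1)/2\rfloor$. Let $$\nu=\begin{cases}1+(\delta-k+1)\sum_{i=0}^{t-1}(\delta-1)^i & \text{if } g=2t+1,\\ 2+(2\delta-1-k)\sum_{i=0}^{t-1}(\delta-1)^i & \text{if } g=2t+2 \text{ and } \delta\ge 3,\\ 2t+1 & \text{if } g=2t+2\text{ and }\delta=2.\end{cases}$$ Let $q(\overline G)$ be the largest eigenvalue of the signless Laplacian matrix $D(\overline G)+A(\overline G)$ of the complement $\overline G$ of $G$, where $D$ is the diagonal matrix of vertex degrees and $A$ the adjacency matrix. Let $\kappa(G)$ be the minimum number of vertices whose deletion leaves a disconnected graph or a single vertex. If $$q(\overline G)\le\begin{cases}2(n-1)-\frac2n(\nu+k-1)^{1+\frac1t}-\frac2n(n-\nu)^{1+\frac1t}-\frac2n(n+k-1) & \text{if } g=2t+1,\\ 2(n-1)-\frac{2}{n\,2^{1/t}}(\nu+k-1)^{1+\frac1t}-\frac{2}{n\,2^{1/t}}(n-\nu)^{1+\frac1t}-\frac2n(n+k-1)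 & \text{if } g=2t+2,\end{cases}$$ then $G$ is $k$-connected, that is, $\kappa(G)\ge k$. -/

import Mathlib

namespace SimpleGraph

/-- A set `C` of vertices is a vertex-cut of `G` if `G - C` is disconnected or is a single vertex.
The second alternative is what gives `κ(K_n) = n - 1`. -/
def IsVertexCut {V : Type*} (G : SimpleGraph V) (C : Finset V) : Prop :=
  ¬ (G.induce {v : V | v ∉ C}).Preconnected ∨ Nat.card {v : V | v ∉ C} = 1

/-- The vertex connectivity `κ(G)`: the least size of a vertex-cut. (A finite nonempty graph always
has a vertex-cut, so this minimum is attained.) -/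
noncomputable def vertexConnectivity {V : Type*} (G : SimpleGraph V) : ℕ :=
  sInf {c : ℕ | ∃ C : Finset V, G.IsVertexCut C ∧ C.card = c}

/-- `G` is `k`-connected if `κ(G) ≥ k`. -/
def IsKConnected {V : Type*} (G : SimpleGraph V) (k : ℕ) : Prop :=
  k ≤ G.vertexConnectivity

/-- The signless Laplacian `Q(G) = D(G) + A(G)`. -/
def signlessLaplacian {V : Type*} [Fintype V] [DecidableEq V] (G : SimpleGraph V)
    [DecidableRel G.Adj] : Matrix V V ℝ :=
  G.degMatrix ℝ + G.adjMatrix ℝ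

/-- The `Q`-index `q(G)`: the largest eigenvalue of the (real symmetric) matrix `Q(G)`. -/
noncomputable def qIndex {V : Type*} [Fintype V] [DecidableEq V] (G : SimpleGraph V)
    [DecidableRel G.Adj] : ℝ :=
  sSup (spectrum ℝ G.signlessLaplacian)

end SimpleGraph

/-- `t = ⌊(g - 1) / 2⌋`, so that `g = 2t + 1` or `g = 2t + 2`. -/
def girthHalf (g : ℕ) : ℕ := (g - 1) / 2

/-- The integer `ν(δ, g, κ)` (with `t = ⌊(g - 1) / 2⌋`); the last case is meant for `δ = 2`. -/
def nuBound (δ g κ : ℕ) : ℤ :=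
  if Odd g then
    1 + ((δ : ℤ) - κ) * ∑ i ∈ Finset.range (girthHalf g), ((δ : ℤ) - 1) ^ i
  else if 3 ≤ δ then
    2 + (2 * (δ : ℤ) - 2 - κ) * ∑ i ∈ Finset.range (girthHalf g), ((δ : ℤ) - 1) ^ i
  else
    2 * (girthHalf g : ℤ) + 1

/-! Argue by contraposition. If `κ(G) < k`, a cut `C` with fewer than `k` vertices splits the other
vertices into nonempty sets `A` and `B` with no edge between them. Each has at least `ν` vertices
(`nuBound_le_card`): grow a tree from a vertex of the set (`g` odd) or from an edge inside it (`g`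
even, `δ ≥ 3`). The girth makes its branches disjoint, so each vertex of `C` spoils at most one
branch, and the unspoiled branches stay in the set. For `g` even and `δ = 2`, the set together with
at most one cut vertex contains a cycle.

Every edge of `G` lies in `G[A ∪ C]` or `G[B ∪ C]`. Both have girth at least `g = 2t + c` with `c ∈
{1, 2}`, and such a graph on `m` vertices has `e` edges with `2e < m (m / c)^(1/t) + m`
(`two_mul_card_edgeFinset_lt`). The two orders add up to `n + |C|`, so by convexity of `x^(1 + 1/t)`
the worst case is the extreme split `ν + |C|`, `n - ν`. Hence `G` has few edges and its complement
many, and the Rayleigh quotient of the all-ones vector, `q ≥ 4e / n`, contradicts the spectral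
hypothesis.

The edge bound comes from a Moore bound in terms of the average degree `d`. Jensen's inequality,
applied to logarithms of path counts, shows that there are at least `nd (d - 1)^l` paths of length
`l + 1`; the girth bounds their number from above. -/

open Finset

namespace SimpleGraph

/-! ### Paths shorter than the girth allows are determined by their ends. -/

section Girth

variable {V : Type*} {G : SimpleGraph V}

/-- Two distinct paths with common endpoints enclose a cycle no longer than their total length. -/
theorem Walk.IsPath.egirth_le_add_length {u v : V} {p q : G.Walk u v} (hp : p.IsPath)
    (hq : q.IsPath) (hne : p ≠ q) : G.egirth ≤ (p.length + q.length : ℕ) := by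
  classical
  -- `H` is the union of the two paths. Two distinct paths with the same ends rule out a forest, and
  -- a cycle of `H` uses each edge at most once.
  set H : SimpleGraph V := fromEdgeSet {e | e ∈ p.edges ∨ e ∈ q.edges} with hH
  have hHG : H ≤ G := by
    intro a b hab
    rw [hH, fromEdgeSet_adj] at hab
    rcases hab.1 with h | h
    · exact p.adj_of_mem_edges h
    · exact q.adj_of_mem_edges h
  have hpe : ∀ e ∈ p.edges, e ∈ H.edgeSet := by
    intro e he
    rw [hH, edgeSet_fromEdgeSet]
    exact ⟨Or.inl he, G.not_isDiag_of_mem_edgeSet (p.edges_subset_edgeSet he)⟩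
  have hqe : ∀ e ∈ q.edges, e ∈ H.edgeSet := by
    intro e he
    rw [hH, edgeSet_fromEdgeSet]
    exact ⟨Or.inr he, G.not_isDiag_of_mem_edgeSet (q.edges_subset_edgeSet he)⟩
  have hcyc : ¬ H.IsAcyclic := by
    intro hac
    have := (hac.subsingleton_path u v).elim ⟨p.transfer H hpe, hp.transfer hpe⟩
      ⟨q.transfer H hqe, hq.transfer hqe⟩
    have h2 : p.transfer H hpe = q.transfer H hqe := congrArg Subtype.val this
    apply hne
    have h3 := congrArg Walk.support h2
    rw [Walk.support_transfer, Walk.support_transfer] at h3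
    exact Walk.ext_support h3
  obtain ⟨a, c, hc, -⟩ := exists_egirth_eq_length.mpr hcyc
  have hlen : c.length ≤ p.length + q.length := by
    rw [← c.length_edges, ← p.length_edges, ← q.length_edges, ← List.length_append]
    apply (hc.isTrail.edges_nodup.subperm _).length_le
    intro e he
    have h1 := c.edges_subset_edgeSet he
    rw [hH, edgeSet_fromEdgeSet] at h1
    rw [List.mem_append]
    exact h1.1
  calc G.egirth ≤ H.egirth := egirth_anti hHG
    _ ≤ c.length := egirth_le_length hc
    _ ≤ _ := by exact_mod_cast hlen

theorem Walk.IsPath.eq_of_add_length_lt_egirth {u v : V} {p q : G.Walk u v} (hp : p.IsPath)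
    (hq : q.IsPath) (h : ((p.length + q.length : ℕ) : ℕ∞) < G.egirth) : p = q := by
  by_contra hne
  exact absurd (hp.egirth_le_add_length hq hne) (not_le.mpr h)

theorem egirth_le_egirth_induce (s : Set V) : G.egirth ≤ (G.induce s).egirth :=
  IsContained.egirth_le ⟨(Embedding.induce s).toCopy⟩

/-- The ends of the paths of length `l + 1` that start with the edge from `u` to `v`. -/
def pathEnds (G : SimpleGraph V) (l : ℕ) (u v : V) : Set V :=
  {x | ∃ (h : G.Adj u v) (p : G.Walk v x), (Walk.cons h p).IsPath ∧ p.length = l}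

theorem pathEnds_zero {u v : V} (h : G.Adj u v) : G.pathEnds 0 u v = {v} := by
  ext x
  constructor
  · rintro ⟨_, p, hp, hl⟩
    exact (Walk.eq_of_length_eq_zero hl).symm
  · rintro rfl
    exact ⟨h, Walk.nil, by simp [h.ne], rfl⟩

/-- Prepending `u` to a path from `v` whose first step avoids `u` gives a path again: if it returned
to `u`, its initial segment and the edge `vu` would be distinct paths of total length at most `l +
2`. -/
theorem pathEnds_succ {u v : V} {l : ℕ} (h : G.Adj u v) (hl : ((l + 2 : ℕ) : ℕ∞) < G.egirth) :
    G.pathEnds (l + 1) u v = ⋃ w ∈ {w | G.Adj v w ∧ w ≠ u}, G.pathEnds l v w := by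
  classical
  ext x
  simp only [Set.mem_iUnion, Set.mem_ofPred_eq]
  constructor
  · rintro ⟨h', p, hp, hlen⟩
    cases p with
    | nil => simp at hlen
    | @cons _ w _ hvw q =>
      refine ⟨w, ⟨hvw, ?_⟩, hvw, q, hp.of_cons, by simpa using hlen⟩
      rintro rfl
      rw [Walk.cons_isPath_iff] at hp
      apply hp.2
      rw [Walk.support_cons]
      exact List.mem_cons_of_mem _ q.start_mem_support
  · rintro ⟨w, ⟨hvw, hwu⟩, _, q, hq, hlen⟩
    refine ⟨h, Walk.cons hvw q, ?_, by simp [hlen]⟩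
    rw [Walk.cons_isPath_iff]
    refine ⟨hq, fun hu => ?_⟩
    have hp1 := hq.takeUntil hu
    have hp2 : (Walk.cons h.symm Walk.nil : G.Walk v u).IsPath := by simp [h.ne']
    have hle := Walk.length_takeUntil_le_length _ hu
    rw [Walk.length_cons, hlen] at hle
    have heq := hp1.eq_of_add_length_lt_egirth hp2 (lt_of_le_of_lt (by
      simp only [Walk.length_cons, Walk.length_nil]
      exact_mod_cast (by omega)) hl)
    have hs := congrArg Walk.snd heq
    rw [Walk.snd_takeUntil h.ne] at hs
    exact hwu (by simpa using hs)

theorem start_notMem_pathEnds {u v : V} {l : ℕ} : u ∉ G.pathEnds l u v := by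
  rintro ⟨h, p, hp, -⟩
  rw [Walk.cons_isPath_iff] at hp
  exact hp.2 p.end_mem_support

theorem disjoint_pathEnds {u v v' : V} {l l' : ℕ} (hne : v ≠ v' ∨ l ≠ l')
    (hl : ((l + l' + 2 : ℕ) : ℕ∞) < G.egirth) :
    Disjoint (G.pathEnds l u v) (G.pathEnds l' u v') := by
  rw [Set.disjoint_left]
  rintro x ⟨h, p, hp, rfl⟩ ⟨h', p', hp', rfl⟩
  have := hp.eq_of_add_length_lt_egirth hp' (by
    convert hl using 2
    simp only [Walk.length_cons]
    omega)
  rcases hne with hne | hne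
  · exact hne (by simpa using congrArg Walk.snd this)
  · exact hne (by simpa using congrArg Walk.length this)

/-- A common end would be joined to `u` by one path through `v` and, after dropping the first edge
of the other, by one avoiding `v`. -/
theorem disjoint_pathEnds_swap {u v : V} {l l' : ℕ}
    (hl : ((l + l' + 1 : ℕ) : ℕ∞) < G.egirth) :
    Disjoint (G.pathEnds l u v) (G.pathEnds l' v u) := by
  rw [Set.disjoint_left]
  rintro x ⟨h, p, hp, rfl⟩ ⟨h', p', hp', rfl⟩
  rw [Walk.cons_isPath_iff] at hp'
  have := hp.eq_of_add_length_lt_egirth hp'.1 (by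
    convert hl using 2
    simp only [Walk.length_cons]
    omega)
  apply hp'.2
  rw [← this, Walk.support_cons]
  exact List.mem_cons_of_mem _ p.start_mem_support

/-- Prepending the edge `uv` to the second family makes both families start at `u`, with different
first steps. -/
theorem disjoint_pathEnds_adj {u v w w' : V} {l l' : ℕ} (h : G.Adj u v) (hw : w ≠ v)
    (hw' : w' ≠ u) (hl : ((l + l' + 3 : ℕ) : ℕ∞) < G.egirth) :
    Disjoint (G.pathEnds l u w) (G.pathEnds l' v w') := by
  have hsub : G.pathEnds l' v w' ⊆ G.pathEnds (l' + 1) u v := by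
    rw [pathEnds_succ h (lt_of_le_of_lt (by exact_mod_cast (by omega)) hl)]
    intro x hx
    simp only [Set.mem_iUnion]
    exact ⟨w', ⟨hx.1, hw'⟩, hx⟩
  exact (disjoint_pathEnds (Or.inl hw) (by convert hl using 2; omega)).mono_right hsub

/-- A vertex reached by a path of length at least two is adjacent to the end of a shorter one. -/
theorem exists_adj_of_mem_pathEnds_succ {u v x : V} {l : ℕ} (hx : x ∈ G.pathEnds (l + 1) u v) :
    ∃ y ∈ G.pathEnds l u v, G.Adj y x := by
  obtain ⟨h, p, hp, hlen⟩ := hx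
  have hnil : ¬ p.Nil := by
    rw [← Walk.length_eq_zero_iff]
    omega
  refine ⟨p.penultimate, ⟨h, p.dropLast, ?_, ?_⟩, p.adj_penultimate hnil⟩
  · rw [Walk.cons_isPath_iff] at hp ⊢
    refine ⟨hp.1.dropLast, fun hu => hp.2 ?_⟩
    rw [Walk.support_dropLast hnil] at hu
    exact List.mem_of_mem_dropLast hu
  · have := Walk.length_dropLast_add_one hnil
    omega

end Girth

/-! ### Counting path ends and the branches of the Moore tree. -/

section Finset

variable {V : Type*} [Fintype V] {G : SimpleGraph V}

open Classical in
/-- The ends of the paths of length `l + 1` that start with the edge from `u` to `v`,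
as a `Finset`. -/
noncomputable def pathEndFinset (G : SimpleGraph V) (l : ℕ) (u v : V) : Finset V :=
  univ.filter (· ∈ G.pathEnds l u v)

@[simp]
theorem mem_pathEndFinset {l : ℕ} {u v x : V} :
    x ∈ G.pathEndFinset l u v ↔ x ∈ G.pathEnds l u v := by
  simp [pathEndFinset]

theorem disjoint_pathEndFinset_iff {l l' : ℕ} {u v u' v' : V} :
    Disjoint (G.pathEndFinset l u v) (G.pathEndFinset l' u' v') ↔
      Disjoint (G.pathEnds l u v) (G.pathEnds l' u' v') := by
  simp [Finset.disjoint_left, Set.disjoint_left]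

theorem card_pathEndFinset_zero {u v : V} (h : G.Adj u v) : (G.pathEndFinset 0 u v).card = 1 := by
  rw [Finset.card_eq_one]
  refine ⟨v, ?_⟩
  ext x
  simp [pathEnds_zero h]

variable [DecidableEq V]

theorem card_pathEndFinset_succ [DecidableRel G.Adj] {u v : V} {l : ℕ} (h : G.Adj u v)
    (hl : ((2 * l + 2 : ℕ) : ℕ∞) < G.egirth) :
    (G.pathEndFinset (l + 1) u v).card =
      ∑ w ∈ (G.neighborFinset v).erase u, (G.pathEndFinset l v w).card := by
  rw [← Finset.card_biUnion]
  · congr 1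
    ext x
    rw [mem_pathEndFinset, pathEnds_succ h (lt_of_le_of_lt (by exact_mod_cast (by omega)) hl)]
    simp only [Set.mem_iUnion, Set.mem_ofPred_eq, Finset.mem_biUnion, Finset.mem_erase,
      mem_neighborFinset, mem_pathEndFinset, exists_prop]
    tauto
  · intro w _ w' _ hne
    rw [Function.onFun, disjoint_pathEndFinset_iff]
    exact disjoint_pathEnds (Or.inl hne) (by convert hl using 2; omega)

theorem pow_le_card_pathEndFinset [DecidableRel G.Adj] {δ l : ℕ} (hδ : ∀ v, δ ≤ G.degree v)
    (hl : ((2 * l : ℕ) : ℕ∞) < G.egirth) {u v : V} (h : G.Adj u v) :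
    (δ - 1) ^ l ≤ (G.pathEndFinset l u v).card := by
  induction l generalizing u v with
  | zero => simp [card_pathEndFinset_zero h]
  | succ l ih =>
    rw [card_pathEndFinset_succ h (by convert hl using 2; omega), pow_succ', ← smul_eq_mul]
    calc (δ - 1) • (δ - 1) ^ l ≤ ((G.neighborFinset v).erase u).card • (δ - 1) ^ l := by
          have : u ∈ G.neighborFinset v := by simpa using h.symm
          have hc : δ - 1 ≤ ((G.neighborFinset v).erase u).card := by
            rw [Finset.card_erase_of_mem this, card_neighborFinset_eq_degree]
            exact Nat.sub_le_sub_right (hδ v) 1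
          exact Nat.mul_le_mul_right _ hc
      _ ≤ _ := by
          apply Finset.card_nsmul_le_sum
          intro w hw
          apply ih (lt_of_le_of_lt (by exact_mod_cast (by omega)) hl)
          simpa using (Finset.mem_erase.mp hw).2

/-- The vertices other than `u` reached by a path of length at most `m` that starts with the edge
from `u` to `v`. -/
noncomputable def pathBranch (G : SimpleGraph V) (m : ℕ) (u v : V) : Finset V :=
  (range m).biUnion fun i => G.pathEndFinset i u v

theorem mem_pathBranch {m : ℕ} {u v x : V} :
    x ∈ G.pathBranch m u v ↔ ∃ i < m, x ∈ G.pathEnds i u v := by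
  simp [pathBranch]

theorem sum_pow_le_card_pathBranch [DecidableRel G.Adj] {δ m : ℕ} (hδ : ∀ v, δ ≤ G.degree v)
    (hm : ((2 * m : ℕ) : ℕ∞) < G.egirth) {u v : V} (h : G.Adj u v) :
    ∑ i ∈ range m, (δ - 1) ^ i ≤ (G.pathBranch m u v).card := by
  rw [pathBranch, Finset.card_biUnion]
  · apply Finset.sum_le_sum
    intro i hi
    rw [Finset.mem_range] at hi
    exact pow_le_card_pathEndFinset hδ (lt_of_le_of_lt (by exact_mod_cast (by omega)) hm) h
  · intro i hi j hj hij
    rw [Finset.mem_coe, Finset.mem_range] at hi hj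
    rw [Function.onFun, disjoint_pathEndFinset_iff]
    exact disjoint_pathEnds (Or.inr hij) (lt_of_le_of_lt (by exact_mod_cast (by omega)) hm)

theorem start_notMem_pathBranch {m : ℕ} {u v : V} : u ∉ G.pathBranch m u v := by
  rw [mem_pathBranch]
  rintro ⟨i, -, h⟩
  exact start_notMem_pathEnds h

theorem disjoint_pathBranch {m : ℕ} (hm : ((2 * m : ℕ) : ℕ∞) < G.egirth) {u v v' : V}
    (hne : v ≠ v') : Disjoint (G.pathBranch m u v) (G.pathBranch m u v') := by
  rw [Finset.disjoint_left]
  intro x hx hx'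
  obtain ⟨i, hi, hx⟩ := mem_pathBranch.mp hx
  obtain ⟨j, hj, hx'⟩ := mem_pathBranch.mp hx'
  exact Set.disjoint_left.mp (disjoint_pathEnds (Or.inl hne)
    (lt_of_le_of_lt (by exact_mod_cast (by omega)) hm)) hx hx'

theorem disjoint_pathBranch_adj {m : ℕ} (hm : ((2 * m + 1 : ℕ) : ℕ∞) < G.egirth) {u v w w' : V}
    (h : G.Adj u v) (hw : w ≠ v) (hw' : w' ≠ u) :
    Disjoint (G.pathBranch m u w) (G.pathBranch m v w') := by
  rw [Finset.disjoint_left]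
  intro x hx hx'
  obtain ⟨i, hi, hx⟩ := mem_pathBranch.mp hx
  obtain ⟨j, hj, hx'⟩ := mem_pathBranch.mp hx'
  exact Set.disjoint_left.mp (disjoint_pathEnds_adj h hw hw'
    (lt_of_le_of_lt (by exact_mod_cast (by omega)) hm)) hx hx'

/-- `v` lies in its own branch at `u`, which is disjoint from the branch of `w`. -/
theorem notMem_pathBranch_of_adj {m : ℕ} (hm : ((2 * m : ℕ) : ℕ∞) < G.egirth) {u v w : V}
    (h : G.Adj u v) (hw : w ≠ v) : v ∉ G.pathBranch m u w := by
  rintro hv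
  have hm0 : 0 < m := by
    obtain ⟨i, hi, -⟩ := mem_pathBranch.mp hv
    omega
  refine Finset.disjoint_left.mp (disjoint_pathBranch hm hw) hv ?_
  rw [mem_pathBranch]
  exact ⟨0, hm0, by rw [pathEnds_zero h]; rfl⟩

/-- A branch starting in a set whose boundary lies in `C` stays in that set if it avoids `C`. -/
theorem pathBranch_subset {A C : Finset V} (hAC : ∀ a ∈ A, ∀ b, G.Adj a b → b ∈ A ∨ b ∈ C)
    {m : ℕ} {u v : V} (hu : u ∈ A) (hC : Disjoint (G.pathBranch m u v) C) :
    G.pathBranch m u v ⊆ A := by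
  have key : ∀ i < m, ∀ x ∈ G.pathEnds i u v, x ∈ A := by
    intro i
    induction i with
    | zero =>
      intro hi x hx
      obtain ⟨h, -⟩ := id hx
      have hxC := Finset.disjoint_left.mp hC (mem_pathBranch.mpr ⟨0, hi, hx⟩)
      rw [pathEnds_zero h] at hx
      obtain rfl : x = v := hx
      exact (hAC u hu x h).resolve_right hxC
    | succ i ih =>
      intro hi x hx
      have hxC := Finset.disjoint_left.mp hC (mem_pathBranch.mpr ⟨i + 1, hi, hx⟩)
      obtain ⟨y, hy, hyx⟩ := exists_adj_of_mem_pathEnds_succ hx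
      exact (hAC y (ih (by omega) y hy) x hyx).resolve_right hxC
  intro x hx
  obtain ⟨i, hi, hx⟩ := mem_pathBranch.mp hx
  exact key i hi x hx

end Finset

end SimpleGraph

/-! ### Convexity and Jensen inequalities for logarithms. -/

section Analysis

theorem convexOn_mul_log_sub_one :
    ConvexOn ℝ (Set.Ici 2) fun x : ℝ => x * Real.log (x - 1) := by
  have hd : ∀ x ∈ Set.Ioi (2 : ℝ),
      HasDerivAt (fun x : ℝ => x * Real.log (x - 1)) (Real.log (x - 1) + x / (x - 1)) x := by
    intro x hx
    rw [Set.mem_Ioi] at hx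
    have h1 : HasDerivAt (fun x : ℝ => Real.log (x - 1)) (1 / (x - 1)) x :=
      ((hasDerivAt_id x).sub_const 1).log (by simp only [id]; linarith)
    refine ((hasDerivAt_id' x).fun_mul h1).congr_deriv ?_
    rw [one_mul, mul_one_div]
  apply MonotoneOn.convexOn_of_deriv (convex_Ici 2)
  · apply ContinuousOn.mul continuousOn_id
    apply ContinuousOn.log (by fun_prop)
    intro x hx
    rw [Set.mem_Ici] at hx
    linarith
  · rw [interior_Ici]
    exact fun x hx => (hd x hx).differentiableAt.differentiableWithinAt
  · rw [interior_Ici]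
    intro x hx y hy hxy
    rw [(hd x hx).deriv, (hd y hy).deriv]
    rw [Set.mem_Ioi] at hx hy
    have hx1 : 0 < x - 1 := by linarith
    have hy1 : 0 < y - 1 := by linarith
    -- Monotonicity of the derivative reduces to `log z ≥ 1 - 1/z` at `z = (y - 1) / (x - 1)`; the
    -- remaining rational term is nonnegative because `x ≥ 2`.
    have hlog : 1 - ((y - 1) / (x - 1))⁻¹ ≤ Real.log ((y - 1) / (x - 1)) :=
      Real.one_sub_inv_le_log_of_pos (by positivity)
    rw [Real.log_div hy1.ne' hx1.ne'] at hlog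
    have h2 : x / (x - 1) - y / (y - 1) ≤ 1 - ((y - 1) / (x - 1))⁻¹ := by
      have : 1 - ((y - 1) / (x - 1))⁻¹ - (x / (x - 1) - y / (y - 1)) =
          (y - x) * (x - 2) / ((x - 1) * (y - 1)) := by
        field_simp
        ring
      have h3 : 0 ≤ (y - x) * (x - 2) / ((x - 1) * (y - 1)) := by
        apply div_nonneg
        · exact mul_nonneg (by linarith) (by linarith)
        · positivity
      linarith
    linarith

theorem sum_log_le_card_mul_log {ι : Type*} {s : Finset ι} (hs : s.Nonempty) {a : ι → ℝ}
    (ha : ∀ i ∈ s, 0 < a i) :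
    ∑ i ∈ s, Real.log (a i) ≤ s.card * Real.log ((∑ i ∈ s, a i) / s.card) := by
  have hc : (0 : ℝ) < s.card := by exact_mod_cast hs.card_pos
  have h := strictConcaveOn_log_Ioi.concaveOn.le_map_sum (t := s)
    (w := fun _ => (s.card : ℝ)⁻¹) (p := a) (fun _ _ => by positivity)
    (by rw [Finset.sum_const, nsmul_eq_mul, mul_inv_cancel₀ hc.ne']) ha
  simp only [smul_eq_mul, ← Finset.mul_sum] at h
  rw [inv_mul_le_iff₀ hc, inv_mul_eq_div] at h
  exact h

/-- Apply concavity of `log` to each sum with one term left out. Every `log (a j)` then occurs `|s|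
- 1` times with weight `1 / (|s| - 1)`, hence once in total. With `s` the neighbourhood of a vertex,
this is one step of a non-backtracking walk. -/
theorem card_mul_log_add_sum_log_le {ι : Type*} [DecidableEq ι] {s : Finset ι}
    (hs : 2 ≤ s.card) {a : ι → ℝ} (ha : ∀ i ∈ s, 0 < a i) :
    s.card * Real.log (s.card - 1) + ∑ i ∈ s, Real.log (a i) ≤
      ∑ i ∈ s, Real.log (∑ j ∈ s.erase i, a j) := by
  have hs2 : (2 : ℝ) ≤ s.card := by exact_mod_cast hs
  have hc : (0 : ℝ) < (s.card : ℝ) - 1 := by linarith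
  have key : ∀ i ∈ s, Real.log (s.card - 1) + (∑ j ∈ s, Real.log (a j) - Real.log (a i)) /
      (s.card - 1) ≤ Real.log (∑ j ∈ s.erase i, a j) := by
    intro i hi
    have hcard : ((s.erase i).card : ℝ) = s.card - 1 := by
      rw [Finset.card_erase_of_mem hi, Nat.cast_sub (by omega), Nat.cast_one]
    have hne : (s.erase i).Nonempty := by
      rw [← Finset.card_pos, Finset.card_erase_of_mem hi]
      omega
    have hpos : ∀ j ∈ s.erase i, 0 < a j := fun j hj => ha j (Finset.mem_of_mem_erase hj)
    have h := sum_log_le_card_mul_log hne hpos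
    rw [hcard, Real.log_div (Finset.sum_pos hpos hne).ne' hc.ne'] at h
    rw [← Finset.sum_erase_eq_sub hi]
    have := (div_le_iff₀' hc).mpr h
    linarith
  refine le_trans (le_of_eq ?_) (Finset.sum_le_sum key)
  rw [Finset.sum_add_distrib, Finset.sum_const, nsmul_eq_mul, ← Finset.sum_div,
    Finset.sum_sub_distrib, Finset.sum_const, nsmul_eq_mul]
  field_simp

end Analysis

/-! ### The Alon–Hoory–Linial lower bound on path counts. -/

namespace SimpleGraph

variable {V : Type*} [Fintype V] {G : SimpleGraph V} [DecidableRel G.Adj]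

theorem sum_sum_neighborFinset_comm {M : Type*} [AddCommMonoid M] (f : V → V → M) :
    ∑ u, ∑ v ∈ G.neighborFinset u, f u v = ∑ v, ∑ u ∈ G.neighborFinset v, f u v := by
  apply Finset.sum_comm'
  simp [adj_comm]

theorem two_le_average_degree [Nonempty V] (hdeg : ∀ v, 2 ≤ G.degree v) :
    (2 : ℝ) ≤ (∑ v, (G.degree v : ℝ)) / Fintype.card V := by
  have hn : (0 : ℝ) < Fintype.card V := by exact_mod_cast Fintype.card_pos
  rw [le_div_iff₀ hn]
  calc (2 : ℝ) * Fintype.card V = ∑ _v : V, (2 : ℝ) := by simp [mul_comm]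
    _ ≤ _ := Finset.sum_le_sum fun v _ => by exact_mod_cast hdeg v

theorem sum_degree_mul_log_average_le [Nonempty V] (hdeg : ∀ v, 2 ≤ G.degree v) :
    (∑ v, (G.degree v : ℝ)) * Real.log ((∑ v, (G.degree v : ℝ)) / Fintype.card V - 1) ≤
      ∑ v, G.degree v * Real.log (G.degree v - 1) := by
  have hn : (0 : ℝ) < Fintype.card V := by exact_mod_cast Fintype.card_pos
  have h := convexOn_mul_log_sub_one.map_sum_le (t := (univ : Finset V))
    (w := fun _ => (Fintype.card V : ℝ)⁻¹) (p := fun v => (G.degree v : ℝ))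
    (fun _ _ => by positivity)
    (by rw [Finset.sum_const, nsmul_eq_mul, Finset.card_univ, mul_inv_cancel₀ hn.ne'])
    (fun v _ => by
      rw [Set.mem_Ici]
      exact_mod_cast hdeg v)
  simp only [smul_eq_mul, ← Finset.mul_sum] at h
  rw [inv_mul_eq_div, inv_mul_eq_div, div_mul_eq_mul_div] at h
  exact (div_le_div_iff_of_pos_right hn).mp h

variable [DecidableEq V]

theorem one_le_card_pathEndFinset (hdeg : ∀ v, 2 ≤ G.degree v) {l : ℕ}
    (hl : ((2 * l : ℕ) : ℕ∞) < G.egirth) {u v : V} (h : G.Adj u v) :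
    1 ≤ (G.pathEndFinset l u v).card := by
  simpa using pow_le_card_pathEndFinset hdeg hl h

/-- Lengthening the paths by one edge replaces the count on `(u, v)` by the sum of the counts on
`(v, w)`, `w ≠ u`. At each `v`, `card_mul_log_add_sum_log_le` shows that this gains at least `d(v)
log (d(v) - 1)`. -/
theorem mul_sum_degree_mul_log_le (hdeg : ∀ v, 2 ≤ G.degree v) {l : ℕ}
    (hl : ((2 * l : ℕ) : ℕ∞) < G.egirth) :
    l * ∑ v, G.degree v * Real.log (G.degree v - 1) ≤
      ∑ u, ∑ v ∈ G.neighborFinset u, Real.log (G.pathEndFinset l u v).card := by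
  induction l with
  | zero =>
    apply le_of_eq
    rw [Nat.cast_zero, zero_mul, eq_comm]
    refine Finset.sum_eq_zero fun u _ => Finset.sum_eq_zero fun v hv => ?_
    rw [card_pathEndFinset_zero (by simpa using hv), Nat.cast_one, Real.log_one]
  | succ l ih =>
    have hl' : ((2 * l : ℕ) : ℕ∞) < G.egirth := lt_of_le_of_lt (by exact_mod_cast (by omega)) hl
    have h1 : ∑ u, ∑ v ∈ G.neighborFinset u, Real.log (G.pathEndFinset (l + 1) u v).card =
        ∑ v, ∑ u ∈ G.neighborFinset v,
          Real.log (∑ w ∈ (G.neighborFinset v).erase u, ((G.pathEndFinset l v w).card : ℝ)) := by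
      rw [sum_sum_neighborFinset_comm]
      refine Finset.sum_congr rfl fun v _ => Finset.sum_congr rfl fun u hu => ?_
      rw [card_pathEndFinset_succ (by simpa [adj_comm] using hu) (by convert hl using 2; omega)]
      push_cast
      rfl
    rw [h1]
    have h2 : ∀ v ∈ (univ : Finset V), G.degree v * Real.log (G.degree v - 1) +
        ∑ w ∈ G.neighborFinset v, Real.log (G.pathEndFinset l v w).card ≤
        ∑ u ∈ G.neighborFinset v,
          Real.log (∑ w ∈ (G.neighborFinset v).erase u, ((G.pathEndFinset l v w).card : ℝ)) := by
      intro v _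
      have := card_mul_log_add_sum_log_le (s := G.neighborFinset v)
        (a := fun w => ((G.pathEndFinset l v w).card : ℝ))
        (by rw [card_neighborFinset_eq_degree]; exact hdeg v)
        (fun w hw => by
          exact_mod_cast one_le_card_pathEndFinset hdeg hl' (by simpa using hw))
      rwa [card_neighborFinset_eq_degree] at this
    refine le_trans ?_ (Finset.sum_le_sum h2)
    rw [Finset.sum_add_distrib]
    have := ih hl'
    push_cast
    linarith

/-- The lower bound of Alon, Hoory and Linial on the number of non-backtracking walks of length
`l + 1`, for graphs whose girth makes these walks paths with distinct ends. -/
theorem sum_degree_mul_pow_le_sum_card_pathEndFinset [Nonempty V] (hdeg : ∀ v, 2 ≤ G.degree v)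
    {l : ℕ} (hl : ((2 * l : ℕ) : ℕ∞) < G.egirth) :
    (∑ v, (G.degree v : ℝ)) * ((∑ v, (G.degree v : ℝ)) / Fintype.card V - 1) ^ l ≤
      ∑ u, ∑ v ∈ G.neighborFinset u, ((G.pathEndFinset l u v).card : ℝ) := by
  set D : ℝ := ∑ v, (G.degree v : ℝ) with hD
  have hd := two_le_average_degree hdeg
  rw [← hD] at hd
  have hn : (0 : ℝ) < Fintype.card V := by exact_mod_cast Fintype.card_pos
  have hDpos : 0 < D := by
    rw [le_div_iff₀ hn] at hd
    linarith
  -- The set of oriented edges, of size `D`; Jensen's inequality over it turns the sum of logarithms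
  -- into the logarithm of an average.
  set S : Finset (Σ _ : V, V) := univ.sigma fun u => G.neighborFinset u with hS
  have hScard : (S.card : ℝ) = D := by
    rw [hS, Finset.card_sigma, hD]
    push_cast
    simp
  have hSne : S.Nonempty := by
    rw [← Finset.card_pos]
    exact_mod_cast hScard ▸ hDpos
  have hpos : ∀ e ∈ S, (0 : ℝ) < (G.pathEndFinset l e.1 e.2).card := by
    intro e he
    rw [hS, Finset.mem_sigma, mem_neighborFinset] at he
    exact_mod_cast one_le_card_pathEndFinset hdeg hl he.2
  have h1 := sum_log_le_card_mul_log hSne hpos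
  have h2 := mul_sum_degree_mul_log_le hdeg hl
  have h3 := sum_degree_mul_log_average_le hdeg
  have hsum := Finset.sum_pos hpos hSne
  rw [hScard] at h1
  rw [hS, Finset.sum_sigma, Finset.sum_sigma] at h1
  rw [hS, Finset.sum_sigma] at hsum
  rw [← hD] at h3
  set N := ∑ u, ∑ v ∈ G.neighborFinset u, ((G.pathEndFinset l u v).card : ℝ) with hN
  have h4 : D * (l * Real.log (D / Fintype.card V - 1)) ≤ D * Real.log (N / D) := by
    calc D * (l * Real.log (D / Fintype.card V - 1))
        = l * (D * Real.log (D / Fintype.card V - 1)) := by ring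
      _ ≤ l * ∑ v, G.degree v * Real.log (G.degree v - 1) := by gcongr
      _ ≤ _ := h2.trans h1
  have h5 := le_of_mul_le_mul_left h4 hDpos
  rw [← Real.log_pow, Real.log_le_log_iff (pow_pos (by linarith) l) (div_pos hsum hDpos),
    le_div_iff₀ hDpos] at h5
  linarith

end SimpleGraph

namespace SimpleGraph

/-! ### The Moore bound and the resulting bound on the number of edges. -/

section EdgeBound

theorem sum_card_pathEndFinset_le {V : Type*} [Fintype V] [DecidableEq V] {G : SimpleGraph V}
    [DecidableRel G.Adj] {l : ℕ} (hl : ((2 * l + 2 : ℕ) : ℕ∞) < G.egirth) (u : V) :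
    ∑ v ∈ G.neighborFinset u, (G.pathEndFinset l u v).card ≤ Fintype.card V := by
  rw [← Finset.card_biUnion]
  · exact Finset.card_le_univ _
  · intro v _ w _ hne
    rw [Function.onFun, disjoint_pathEndFinset_iff]
    exact disjoint_pathEnds (Or.inl hne) (by convert hl using 2; omega)

/-- The two sets are disjoint, and `u` lies in neither. For `l = 0` this fails, as `u` is then the
end of the path from `v` to `u`. -/
theorem card_pathEndFinset_add_card_pathEndFinset_swap_lt {V : Type*} [Fintype V]
    {G : SimpleGraph V} {l : ℕ} (hl0 : 1 ≤ l) (hl : ((2 * l + 1 : ℕ) : ℕ∞) < G.egirth) {u v : V}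
    (h : G.Adj u v) :
    (G.pathEndFinset l u v).card + (G.pathEndFinset l v u).card < Fintype.card V := by
  classical
  rw [← Finset.card_union_of_disjoint (disjoint_pathEndFinset_iff.mpr
    (disjoint_pathEnds_swap (by convert hl using 2; omega)))]
  apply Finset.card_lt_univ_of_notMem (x := u)
  rw [Finset.mem_union, mem_pathEndFinset, mem_pathEndFinset, not_or]
  refine ⟨start_notMem_pathEnds, fun hu => ?_⟩
  have hd : Disjoint (G.pathEnds 0 v u) (G.pathEnds l v u) :=
    disjoint_pathEnds (Or.inr (by omega)) (lt_of_le_of_lt (by exact_mod_cast (by omega)) hl)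
  rw [pathEnds_zero h.symm] at hd
  exact Set.disjoint_left.mp hd rfl hu

/-- The Moore bound for irregular graphs of minimum degree at least two, in a weak form. -/
theorem mul_average_degree_sub_one_pow_lt {V : Type*} [Fintype V] {G : SimpleGraph V}
    [DecidableRel G.Adj] [Nonempty V] (hdeg : ∀ v, 2 ≤ G.degree v) {c t : ℕ} (hc : c = 1 ∨ c = 2)
    (ht : 1 ≤ t) (hg : ((2 * t + c : ℕ) : ℕ∞) ≤ G.egirth) :
    c * ((∑ v, (G.degree v : ℝ)) / Fintype.card V - 1) ^ t < Fintype.card V := by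
  classical
  have hd := two_le_average_degree hdeg
  have hn : (0 : ℝ) < Fintype.card V := by exact_mod_cast Fintype.card_pos
  set D : ℝ := ∑ v, (G.degree v : ℝ) with hD
  have hDpos : 0 < D := by
    rw [le_div_iff₀ hn] at hd
    linarith
  rcases hc with rfl | rfl
  -- For `c = 1`, paths of length `t` from a fixed vertex have distinct ends, so there are at most
  -- `n * n` in all and `d (d - 1)^(t - 1) ≤ n`.
  · obtain ⟨l, rfl⟩ : ∃ l, t = l + 1 := ⟨t - 1, by omega⟩
    have hl : ((2 * l + 2 : ℕ) : ℕ∞) < G.egirth :=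
      lt_of_lt_of_le (by exact_mod_cast (by omega)) hg
    have h1 := sum_degree_mul_pow_le_sum_card_pathEndFinset hdeg (l := l)
      (lt_of_le_of_lt (by exact_mod_cast (by omega)) hl)
    rw [← hD] at h1
    have h2 : ∑ u, ∑ v ∈ G.neighborFinset u, ((G.pathEndFinset l u v).card : ℝ) ≤
        ∑ _u : V, (Fintype.card V : ℝ) :=
      Finset.sum_le_sum fun u _ => by exact_mod_cast sum_card_pathEndFinset_le hl u
    rw [Finset.sum_const, Finset.card_univ, nsmul_eq_mul] at h2
    have h3 : D = D / Fintype.card V * Fintype.card V := by field_simp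
    set d := D / Fintype.card V with hd'
    have h4 : Fintype.card V * (d * (d - 1) ^ l) ≤ Fintype.card V * Fintype.card V := by
      refine le_trans (le_of_eq ?_) (h1.trans h2)
      rw [h3]
      ring
    have h5 := le_of_mul_le_mul_left h4 hn
    have h6 : 0 < (d - 1) ^ l := pow_pos (by linarith) l
    rw [pow_succ]
    push_cast
    nlinarith
  -- For `c = 2`, paths of length `t + 1` are counted and each oriented edge is paired with its
  -- reverse. A pair contributes at most `n - 1`, which yields the factor 2.
  · have hl : ((2 * t + 1 : ℕ) : ℕ∞) < G.egirth :=
      lt_of_lt_of_le (by exact_mod_cast (by omega)) hg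
    have h1 := sum_degree_mul_pow_le_sum_card_pathEndFinset hdeg (l := t)
      (lt_of_le_of_lt (by exact_mod_cast (by omega)) hl)
    rw [← hD] at h1
    set N := ∑ u, ∑ v ∈ G.neighborFinset u, ((G.pathEndFinset t u v).card : ℝ) with hN
    have h2 : N + N ≤ D * (Fintype.card V - 1) := by
      nth_rewrite 2 [hN]
      rw [sum_sum_neighborFinset_comm, hN, ← Finset.sum_add_distrib, hD, Finset.sum_mul]
      apply Finset.sum_le_sum
      intro u _
      rw [← Finset.sum_add_distrib, ← card_neighborFinset_eq_degree, ← nsmul_eq_mul]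
      apply Finset.sum_le_card_nsmul
      intro v hv
      rw [mem_neighborFinset] at hv
      have := card_pathEndFinset_add_card_pathEndFinset_swap_lt ht hl hv
      rw [le_sub_iff_add_le]
      exact_mod_cast this
    have h3 : D * (2 * (D / Fintype.card V - 1) ^ t) < D * Fintype.card V := by nlinarith
    exact_mod_cast lt_of_mul_lt_mul_left h3 hDpos.le

/-- A graph of girth at least `2 * t + c`, with `c = 1` or `c = 2`, has fewer than
`(n * (n / c) ^ (1 / t) + n) / 2` edges. -/
theorem two_mul_card_edgeFinset_lt {V : Type*} [Fintype V] [Nonempty V] (G : SimpleGraph V)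
    [DecidableRel G.Adj] {c t : ℕ} (hc : c = 1 ∨ c = 2)
    (ht : 1 ≤ t) (hg : ((2 * t + c : ℕ) : ℕ∞) ≤ G.egirth) :
    (2 * G.edgeFinset.card : ℝ) <
      Fintype.card V * (Fintype.card V / c : ℝ) ^ (1 / t : ℝ) + Fintype.card V := by
  classical
  obtain ⟨n, hn⟩ : ∃ n, Fintype.card V = n := ⟨_, rfl⟩
  have hc0 : (0 : ℝ) < c := by rcases hc with rfl | rfl <;> norm_num
  induction n using Nat.strong_induction_on generalizing V with
  | _ n ih =>
  have hpos : 0 < n := hn ▸ Fintype.card_pos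
  have hposR : (0 : ℝ) < n := by exact_mod_cast hpos
  by_cases hdeg : ∀ v, 2 ≤ G.degree v
  · have h1 := mul_average_degree_sub_one_pow_lt hdeg hc ht hg
    have hd := two_le_average_degree hdeg
    have h2 : ∑ v, (G.degree v : ℝ) = 2 * G.edgeFinset.card := by
      exact_mod_cast G.sum_degrees_eq_twice_card_edges
    rw [h2, hn] at h1 hd
    rw [hn]
    set d : ℝ := 2 * G.edgeFinset.card / n with hd'
    have h3 : (d - 1) ^ t < n / c := by
      rw [lt_div_iff₀ hc0]
      linarith
    have h4 : d - 1 < (n / c : ℝ) ^ (1 / t : ℝ) := by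
      have h0 : 0 ≤ d - 1 := by linarith
      have h5 := Real.rpow_lt_rpow (pow_nonneg h0 t) h3 (z := (1 / t : ℝ)) (by positivity)
      rwa [one_div, Real.pow_rpow_inv_natCast h0 (by omega), ← one_div] at h5
    have h6 : (2 * G.edgeFinset.card : ℝ) = n * d := by
      rw [hd']
      field_simp
    rw [h6]
    nlinarith
  -- Delete a vertex of degree at most one. At most one edge is lost, so the left side drops by at
  -- most 2, while for `n ≥ 2` the right side drops by at least `(n / c)^(1/t) + 1 ≥ 2`.
  · push Not at hdeg
    obtain ⟨v, hv⟩ := hdeg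
    rcases Nat.lt_or_ge 1 n with h1n | h1n
    · have hcard : Fintype.card ({v}ᶜ : Set V) = n - 1 := by
        rw [Fintype.card_compl_set, hn]
        simp
      have hne : Nonempty ({v}ᶜ : Set V) := by
        rw [← Fintype.card_pos_iff, hcard]
        omega
      have h1 := ih (n - 1) (by omega) (G.induce {v}ᶜ)
        (hg.trans (egirth_le_egirth_induce _)) hcard
      rw [hcard, card_edgeFinset_induce_compl_singleton, card_edgeFinset_deleteIncidenceSet] at h1
      have h2 : (G.edgeFinset.card : ℝ) ≤ (G.edgeFinset.card - G.degree v : ℕ) + 1 := by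
        exact_mod_cast (by omega)
      have h3 : ((n - 1 : ℕ) : ℝ) = n - 1 := by
        rw [Nat.cast_sub (by omega), Nat.cast_one]
      rw [h3] at h1
      have hn2 : (2 : ℝ) ≤ n := by exact_mod_cast h1n
      have hc2 : (c : ℝ) ≤ 2 := by rcases hc with rfl | rfl <;> norm_num
      have h4 : (1 : ℝ) ≤ (n / c : ℝ) ^ (1 / t : ℝ) :=
        Real.one_le_rpow ((one_le_div hc0).mpr (hc2.trans hn2)) (by positivity)
      have h5 : ((n - 1) / c : ℝ) ^ (1 / t : ℝ) ≤ (n / c : ℝ) ^ (1 / t : ℝ) := by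
        apply Real.rpow_le_rpow
        · exact div_nonneg (by linarith) hc0.le
        · gcongr
          linarith
        · positivity
      rw [hn]
      have h6 := mul_le_mul_of_nonneg_left h5 (by linarith : (0 : ℝ) ≤ n - 1)
      linarith
    · obtain rfl : n = 1 := by omega
      have h0 := G.card_edgeFinset_le_card_choose_two
      rw [hn] at h0
      have h1 : G.edgeFinset.card = 0 := by simpa using h0
      rw [h1, hn]
      have : (0 : ℝ) ≤ ((1 : ℕ) / c : ℝ) ^ (1 / t : ℝ) := by positivity
      push_cast at this ⊢
      linarith

end EdgeBound

/-! ### The signless Laplacian and its Rayleigh quotient. -/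

section QIndex

variable {V : Type*} [Fintype V] [DecidableEq V]

theorem isHermitian_signlessLaplacian (G : SimpleGraph V) [DecidableRel G.Adj] :
    G.signlessLaplacian.IsHermitian := by
  apply Matrix.IsHermitian.add
  · exact Matrix.isHermitian_diagonal _
  · rw [Matrix.IsHermitian, Matrix.conjTranspose_eq_transpose_of_trivial]
    exact G.transpose_adjMatrix

/-- The Rayleigh quotient of the all-ones vector bounds the `Q`-index from below. -/
theorem four_mul_card_edgeFinset_div_le_qIndex [Nonempty V] (G : SimpleGraph V)
    [DecidableRel G.Adj] : (4 * G.edgeFinset.card : ℝ) / Fintype.card V ≤ G.qIndex := by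
  set T := Matrix.toEuclideanLin G.signlessLaplacian with hT
  have hsymm : T.IsSymmetric :=
    Matrix.isSymmetric_toEuclideanLin_iff.mpr G.isHermitian_signlessLaplacian
  have heig := hsymm.hasEigenvalue_iSup_of_finiteDimensional
  have hmem := heig.mem_spectrum
  have hspec : spectrum ℝ T = spectrum ℝ G.signlessLaplacian := Matrix.spectrum_toLpLin 2
  -- Finiteness bounds the spectrum, so the `sSup` in `qIndex` dominates every eigenvalue.
  have hfin : (spectrum ℝ G.signlessLaplacian).Finite := hspec ▸ Module.End.finite_spectrum T
  rw [hspec] at hmem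
  refine le_trans ?_ (le_csSup hfin.bddAbove hmem)
  set x : EuclideanSpace ℝ V := WithLp.toLp 2 (fun _ => 1) with hx
  have hn : (0 : ℝ) < Fintype.card V := by exact_mod_cast Fintype.card_pos
  have hnorm : ‖x‖ ^ 2 = Fintype.card V := by
    rw [EuclideanSpace.norm_sq_eq]
    simp [hx]
  have hx0 : x ≠ 0 := by
    rintro h0
    rw [h0] at hnorm
    simp only [norm_zero, ne_eq, OfNat.ofNat_ne_zero, not_false_eq_true, zero_pow] at hnorm
    exact hn.ne hnorm
  have hval : inner ℝ (T x) x = (4 * G.edgeFinset.card : ℝ) := by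
    have hdeg : ∑ v, (G.degree v : ℝ) = 2 * G.edgeFinset.card := by
      exact_mod_cast G.sum_degrees_eq_twice_card_edges
    have hrow : ∀ v, (G.signlessLaplacian.mulVec fun _ => (1 : ℝ)) v = 2 * G.degree v := by
      intro v
      rw [signlessLaplacian, Matrix.add_mulVec, Pi.add_apply, degMatrix, Matrix.mulVec_diagonal,
        adjMatrix_mulVec_apply]
      simp only [mul_one, Finset.sum_const, card_neighborFinset_eq_degree, nsmul_eq_mul]
      ring
    rw [hT, hx, Matrix.toLpLin_toLp, EuclideanSpace.inner_toLp_toLp]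
    simp only [dotProduct, star_trivial, Matrix.toLin'_apply, hrow, one_mul, ← Finset.mul_sum, hdeg]
    ring
  have hbdd : BddAbove (Set.range fun x : {x : EuclideanSpace ℝ V // x ≠ 0} =>
      RCLike.re (inner ℝ (T x) (x : EuclideanSpace ℝ V)) / ‖(x : EuclideanSpace ℝ V)‖ ^ 2) := by
    refine ⟨‖T.toContinuousLinearMap‖, ?_⟩
    rintro _ ⟨y, rfl⟩
    exact (le_abs_self _).trans (T.toContinuousLinearMap.rayleighQuotient_le_norm y)
  have := le_ciSup hbdd ⟨x, hx0⟩
  simp only [hval, hnorm] at this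
  exact this

end QIndex

end SimpleGraph

/-- Disjointness lets each point of `C` meet at most one `B i`, so at least `|I| - |C|` of these
sets avoid `C` and lie disjointly in `A`. -/
theorem Finset.sub_card_mul_le_card_of_pairwiseDisjoint {ι V : Type*} [DecidableEq V]
    {I : Finset ι} {B : ι → Finset V} {A C : Finset V} {s : ℕ}
    (hdisj : (I : Set ι).PairwiseDisjoint B) (hs : ∀ i ∈ I, s ≤ (B i).card)
    (hsub : ∀ i ∈ I, Disjoint (B i) C → B i ⊆ A) : (I.card - C.card) * s ≤ A.card := by
  classical
  have hbad : (I.filter fun i => ¬ Disjoint (B i) C).card ≤ C.card := by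
    have hd : ((I.filter fun i => ¬ Disjoint (B i) C : Finset ι) : Set ι).PairwiseDisjoint
        fun i => B i ∩ C := by
      intro i hi j hj hij
      rw [Finset.mem_coe, Finset.mem_filter] at hi hj
      exact (hdisj hi.1 hj.1 hij).mono Finset.inter_subset_left Finset.inter_subset_left
    calc (I.filter fun i => ¬ Disjoint (B i) C).card
        = ∑ i ∈ I.filter fun i => ¬ Disjoint (B i) C, 1 := by simp
      _ ≤ ∑ i ∈ I.filter fun i => ¬ Disjoint (B i) C, (B i ∩ C).card := by
          apply Finset.sum_le_sum
          intro i hi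
          exact Finset.card_pos.mpr (Finset.not_disjoint_iff_nonempty_inter.mp
            (Finset.mem_filter.mp hi).2)
      _ = ((I.filter fun i => ¬ Disjoint (B i) C).biUnion fun i => B i ∩ C).card :=
          (Finset.card_biUnion hd).symm
      _ ≤ C.card := Finset.card_le_card (Finset.biUnion_subset.mpr fun i _ =>
          Finset.inter_subset_right)
  have hsplit := Finset.card_filter_add_card_filter_not (s := I) fun i => Disjoint (B i) C
  calc (I.card - C.card) * s ≤ (I.filter fun i => Disjoint (B i) C).card * s :=
        Nat.mul_le_mul_right _ (by omega)
    _ ≤ ∑ i ∈ I.filter fun i => Disjoint (B i) C, (B i).card := by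
        rw [← smul_eq_mul]
        exact Finset.card_nsmul_le_sum _ _ _ fun i hi => hs i (Finset.mem_filter.mp hi).1
    _ = ((I.filter fun i => Disjoint (B i) C).biUnion B).card := by
        refine (Finset.card_biUnion fun i hi j hj hij => ?_).symm
        exact hdisj (Finset.mem_filter.mp hi).1 (Finset.mem_filter.mp hj).1 hij
    _ ≤ A.card := Finset.card_le_card (Finset.biUnion_subset.mpr fun i hi =>
        hsub i (Finset.mem_filter.mp hi).1 (Finset.mem_filter.mp hi).2)

namespace SimpleGraph

/-! ### Degree conditions that force a cycle. -/

section Acyclic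

theorem egirth_le_card {V : Type*} [Fintype V] {G : SimpleGraph V} (h : ¬ G.IsAcyclic) : G.egirth ≤ Fintype.card V := by
  obtain ⟨a, c, hc, hlen⟩ := exists_egirth_eq_length.mpr h
  rw [hlen]
  have h1 := hc.support_nodup.length_le_card
  rw [List.length_tail, Walk.length_support] at h1
  exact_mod_cast (by simpa using h1)

variable {V : Type*} [Fintype V] {G : SimpleGraph V} [DecidableRel G.Adj]

theorem IsAcyclic.card_edgeFinset_lt_card [Nonempty V] (h : G.IsAcyclic) :
    G.edgeFinset.card < Fintype.card V := by
  classical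
  obtain ⟨F, hGF, -, hF⟩ :=
    (connected_top (V := V)).exists_isTree_le_of_le_of_isAcyclic le_top h
  have h1 := hF.card_edgeFinset
  have h2 := Finset.card_le_card (edgeFinset_mono hGF)
  omega

/-- The degree sum is at least `2(n - 1) + 1`, too large for a forest. The exceptional vertex `x`
will be the cut vertex. -/
theorem not_isAcyclic_of_two_le_degree (x : V) (hx : 1 ≤ G.degree x)
    (hdeg : ∀ v, v ≠ x → 2 ≤ G.degree v) : ¬ G.IsAcyclic := by
  classical
  intro hac
  have : Nonempty V := ⟨x⟩
  have h1 := hac.card_edgeFinset_lt_card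
  have h2 := G.sum_degrees_eq_twice_card_edges
  rw [← Finset.add_sum_erase univ _ (Finset.mem_univ x)] at h2
  have h3 : (univ.erase x).card • 2 ≤ ∑ v ∈ univ.erase x, G.degree v :=
    Finset.card_nsmul_le_sum _ _ _ fun v hv => hdeg v (Finset.ne_of_mem_erase hv)
  rw [Finset.card_erase_of_mem (Finset.mem_univ x), Finset.card_univ, smul_eq_mul] at h3
  omega

end Acyclic

/-! ### Lower bounds on the size of a separated set. -/

section Separation

variable {V : Type*} [Fintype V] [DecidableEq V] {G : SimpleGraph V} [DecidableRel G.Adj]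
  {A C : Finset V} {δ t : ℕ}

/-- Use the tree rooted at some `u ∈ A`: it has at least `δ` branches, at most `|C|` of them meeting
`C`, and the summand 1 is `u` itself. -/
theorem card_lower_bound_of_two_mul_lt_egirth
    (hAC : ∀ a ∈ A, ∀ b, G.Adj a b → b ∈ A ∨ b ∈ C) (hA : A.Nonempty)
    (hδ : ∀ v, δ ≤ G.degree v) (hg : ((2 * t : ℕ) : ℕ∞) < G.egirth) :
    1 + (δ - C.card) * ∑ i ∈ range t, (δ - 1) ^ i ≤ A.card := by
  obtain ⟨u, hu⟩ := hA
  have h := Finset.sub_card_mul_le_card_of_pairwiseDisjoint (I := G.neighborFinset u)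
    (B := fun v => G.pathBranch t u v) (A := A.erase u) (C := C)
    (s := ∑ i ∈ range t, (δ - 1) ^ i)
    (fun v _ w _ hne => disjoint_pathBranch hg hne)
    (fun v hv => sum_pow_le_card_pathBranch hδ hg (by simpa using hv))
    (fun v _ hd x hx => Finset.mem_erase.mpr
      ⟨fun hxu => start_notMem_pathBranch (hxu ▸ hx), pathBranch_subset hAC hu hd hx⟩)
  rw [card_neighborFinset_eq_degree] at h
  have h2 := Finset.card_erase_add_one hu
  have h3 : (δ - C.card) * ∑ i ∈ range t, (δ - 1) ^ i ≤
      (G.degree u - C.card) * ∑ i ∈ range t, (δ - 1) ^ i :=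
    Nat.mul_le_mul_right _ (Nat.sub_le_sub_right (hδ u) _)
  omega

/-- Root the tree at an edge `uv` inside `A`, which exists because `u` has more than `|C|`
neighbours. There are at least `2δ - 2` branches, and the summand 2 counts `u` and `v`. -/
theorem card_lower_bound_of_two_mul_add_one_lt_egirth
    (hAC : ∀ a ∈ A, ∀ b, G.Adj a b → b ∈ A ∨ b ∈ C) (hA : A.Nonempty)
    (hC : C.card < δ)
    (hδ : ∀ v, δ ≤ G.degree v) (hg : ((2 * t + 1 : ℕ) : ℕ∞) < G.egirth) :
    2 + (2 * δ - 2 - C.card) * ∑ i ∈ range t, (δ - 1) ^ i ≤ A.card := by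
  obtain ⟨u, hu⟩ := hA
  have hg' : ((2 * t : ℕ) : ℕ∞) < G.egirth := lt_of_le_of_lt (by exact_mod_cast (by omega)) hg
  obtain ⟨v, hvN, hvC⟩ : ∃ v ∈ G.neighborFinset u, v ∉ C := by
    apply Finset.exists_mem_notMem_of_card_lt_card
    rw [card_neighborFinset_eq_degree]
    exact hC.trans_le (hδ u)
  have huv : G.Adj u v := by simpa using hvN
  have hv : v ∈ A := (hAC u hu v huv).resolve_right hvC
  set I : Finset (V × V) :=
    {u} ×ˢ (G.neighborFinset u).erase v ∪ {v} ×ˢ (G.neighborFinset v).erase u with hI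
  have hmem : ∀ e ∈ I, (e.1 = u ∧ e.2 ≠ v ∧ G.Adj u e.2) ∨ (e.1 = v ∧ e.2 ≠ u ∧ G.Adj v e.2) := by
    intro e he
    rw [hI, Finset.mem_union, Finset.mem_product, Finset.mem_product, Finset.mem_singleton,
      Finset.mem_singleton, Finset.mem_erase, Finset.mem_erase, mem_neighborFinset,
      mem_neighborFinset] at he
    exact he
  have hIcard : I.card = (G.degree u - 1) + (G.degree v - 1) := by
    rw [hI, Finset.card_union_of_disjoint, Finset.card_product, Finset.card_product,
      Finset.card_erase_of_mem hvN, Finset.card_erase_of_mem (by simpa using huv.symm)]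
    · simp
    · rw [Finset.disjoint_left]
      rintro ⟨a, b⟩ h1 h2
      rw [Finset.mem_product, Finset.mem_singleton] at h1 h2
      exact huv.ne (h1.1.symm.trans h2.1)
  have h := Finset.sub_card_mul_le_card_of_pairwiseDisjoint (I := I)
    (B := fun e => G.pathBranch t e.1 e.2) (A := (A.erase u).erase v) (C := C)
    (s := ∑ i ∈ range t, (δ - 1) ^ i) ?_ ?_ ?_
  · have h2 := Finset.card_erase_add_one hu
    have h3 := Finset.card_erase_add_one (Finset.mem_erase.mpr ⟨huv.ne', hv⟩)
    have hu' := hδ u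
    have hv' := hδ v
    have h4 : (2 * δ - 2 - C.card) * ∑ i ∈ range t, (δ - 1) ^ i ≤
        (I.card - C.card) * ∑ i ∈ range t, (δ - 1) ^ i :=
      Nat.mul_le_mul_right _ (by omega)
    omega
  · rintro ⟨a, b⟩ h1 ⟨a', b'⟩ h2 hne
    have h1' := hmem _ h1
    have h2' := hmem _ h2
    dsimp only at h1' h2'
    change Disjoint (G.pathBranch t a b) (G.pathBranch t a' b')
    rcases h1' with ⟨rfl, hb, -⟩ | ⟨rfl, hb, -⟩ <;> rcases h2' with ⟨rfl, hb', -⟩ | ⟨rfl, hb', -⟩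
    · exact disjoint_pathBranch hg' (fun h => hne (by rw [h]))
    · exact disjoint_pathBranch_adj hg huv hb hb'
    · exact disjoint_pathBranch_adj hg huv.symm hb hb'
    · exact disjoint_pathBranch hg' (fun h => hne (by rw [h]))
  · rintro ⟨a, b⟩ h1
    rcases hmem _ h1 with ⟨h, -, hb⟩ | ⟨h, -, hb⟩ <;> dsimp only at h hb ⊢ <;> subst h
    · exact sum_pow_le_card_pathBranch hδ hg' hb
    · exact sum_pow_le_card_pathBranch hδ hg' hb
  · rintro ⟨a, b⟩ h1 hd x hx
    rw [Finset.mem_erase, Finset.mem_erase]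
    rcases hmem _ h1 with ⟨h, hb, -⟩ | ⟨h, hb, -⟩ <;> dsimp only at h hb hd hx <;> subst h
    · refine ⟨fun h => ?_, fun h => ?_, pathBranch_subset hAC hu hd hx⟩
      · exact notMem_pathBranch_of_adj hg' huv hb (h ▸ hx)
      · exact start_notMem_pathBranch (h ▸ hx)
    · refine ⟨fun h => ?_, fun h => ?_, pathBranch_subset hAC hv hd hx⟩
      · exact start_notMem_pathBranch (h ▸ hx)
      · exact notMem_pathBranch_of_adj hg' huv.symm hb (h ▸ hx)

/-- With minimum degree two, a set separated by at most one vertex contains, up to that vertex,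
a cycle. -/
theorem egirth_le_card_add_one
    (hAC : ∀ a ∈ A, ∀ b, G.Adj a b → b ∈ A ∨ b ∈ C) (hA : A.Nonempty)
    (hC : C.card ≤ 1) (hδ : ∀ v, 2 ≤ G.degree v) : G.egirth ≤ (A.card + 1 : ℕ) := by
  -- A vertex of `C` is added only if it has a neighbour in `A`, so that no vertex is isolated in
  -- `G[S]`.
  obtain ⟨S, hS⟩ : ∃ S : Finset V, S = A ∪ C.filter fun x => ∃ a ∈ A, G.Adj a x := ⟨_, rfl⟩
  have hAS : A ⊆ S := hS ▸ Finset.subset_union_left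
  have hSA : ∀ x ∈ S, x ∉ A → x ∈ C ∧ ∃ a ∈ A, G.Adj a x := by
    intro x hx hxA
    rw [hS, Finset.mem_union, Finset.mem_filter] at hx
    exact hx.resolve_left hxA
  have hScard : S.card ≤ A.card + 1 :=
    hS ▸ (Finset.card_union_le _ _).trans
      (Nat.add_le_add_left ((Finset.card_filter_le _ _).trans hC) _)
  set H := G.induce (S : Set V) with hH
  have hnb : ∀ a ∈ A, ∀ b, G.Adj a b → b ∈ S := by
    intro a ha b hab
    rw [hS, Finset.mem_union, Finset.mem_filter]
    rcases hAC a ha b hab with h | h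
    · exact Or.inl h
    · exact Or.inr ⟨h, a, ha, hab⟩
  have hdegA : ∀ v : (S : Set V), (v : V) ∈ A → 2 ≤ H.degree v := by
    intro v hv
    have hsub : G.neighborSet v ⊆ (S : Set V) := fun b hb => hnb v hv b hb
    have h : H.degree v = G.degree v := by
      convert degree_induce_of_neighborSet_subset hsub
    exact (hδ v).trans_eq h.symm
  have hdeg1 : ∀ v : (S : Set V), 1 ≤ H.degree v := by
    intro v
    by_cases hv : (v : V) ∈ A
    · exact (hdegA v hv).trans' (by norm_num)
    · obtain ⟨-, a, ha, hav⟩ := hSA v (Finset.mem_coe.mp v.2) hv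
      have haS : a ∈ (S : Set V) := Finset.mem_coe.mpr (hAS ha)
      exact (degree_pos_iff_exists_adj H v).mpr ⟨⟨a, haS⟩, hav.symm⟩
  have hcyc : ¬ H.IsAcyclic := by
    obtain ⟨a, ha⟩ := hA
    have haS : a ∈ (S : Set V) := Finset.mem_coe.mpr (hAS ha)
    by_cases hx : ∃ x : (S : Set V), (x : V) ∉ A
    · obtain ⟨x, hx⟩ := hx
      refine not_isAcyclic_of_two_le_degree x (hdeg1 x) fun v hv => hdegA v ?_
      by_contra hvA
      have hmemC : ∀ y : (S : Set V), (y : V) ∉ A → (y : V) ∈ C := fun y hy =>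
        (hSA y (Finset.mem_coe.mp y.2) hy).1
      exact hv (Subtype.ext (Finset.card_le_one.mp hC _ (hmemC v hvA) _ (hmemC x hx)))
    · push Not at hx
      exact not_isAcyclic_of_two_le_degree ⟨a, haS⟩ (hdeg1 _) fun v _ => hdegA v (hx v)
  calc G.egirth ≤ H.egirth := egirth_le_egirth_induce _
    _ ≤ Fintype.card (S : Set V) := egirth_le_card hcyc
    _ = S.card := by rw [← Set.toFinset_card, Finset.toFinset_coe]
    _ ≤ _ := by exact_mod_cast hScard

/-- A nonempty union of components of `G - C` has at least `ν(δ, g, κ)` vertices. -/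
theorem nuBound_le_card {g κ : ℕ} (hAC : ∀ a ∈ A, ∀ b, G.Adj a b → b ∈ A ∨ b ∈ C)
    (hA : A.Nonempty) (hCκ : C.card ≤ κ) (hκ : κ < δ) (hδ2 : 2 ≤ δ) (hδ : ∀ v, δ ≤ G.degree v)
    (hg : (g : ℕ∞) ≤ G.egirth) (hg3 : 3 ≤ g) : nuBound δ g κ ≤ A.card := by
  set t := girthHalf g with ht
  have hcast : ((∑ i ∈ range t, (δ - 1) ^ i : ℕ) : ℤ) = ∑ i ∈ range t, ((δ : ℤ) - 1) ^ i := by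
    rw [Nat.cast_sum]
    refine Finset.sum_congr rfl fun i _ => ?_
    rw [Nat.cast_pow, Nat.cast_sub (by omega), Nat.cast_one]
  rw [nuBound, ← ht, ← hcast]
  rw [girthHalf] at ht
  split_ifs with hodd h3
  · obtain ⟨m, rfl⟩ := hodd
    have h := card_lower_bound_of_two_mul_lt_egirth (t := t) hAC hA hδ
      (lt_of_lt_of_le (by exact_mod_cast (by omega)) hg)
    have h' : 1 + (δ - κ) * ∑ i ∈ range t, (δ - 1) ^ i ≤ A.card :=
      le_trans (Nat.add_le_add_left (Nat.mul_le_mul_right _ (by omega)) _) h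
    have h2 : ((δ - κ : ℕ) : ℤ) = δ - κ := Nat.cast_sub hκ.le
    rw [← h2]
    exact_mod_cast h'
  · have hge : 2 * t + 2 = g := by
      obtain ⟨m, rfl⟩ := Nat.not_odd_iff_even.mp hodd
      omega
    have h := card_lower_bound_of_two_mul_add_one_lt_egirth (t := t) hAC hA
      (hCκ.trans_lt hκ) hδ (lt_of_lt_of_le (by exact_mod_cast (by omega)) hg)
    have h' : 2 + (2 * δ - 2 - κ) * ∑ i ∈ range t, (δ - 1) ^ i ≤ A.card :=
      le_trans (Nat.add_le_add_left (Nat.mul_le_mul_right _ (by omega)) _) h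
    have h2 : ((2 * δ - 2 - κ : ℕ) : ℤ) = 2 * δ - 2 - κ := by omega
    rw [← h2]
    exact_mod_cast h'
  -- Here `δ = 2`, so `κ ≤ 1` and the cycle argument gives `|A| ≥ g - 1 = 2t + 1`.
  · have hge : 2 * t + 2 = g := by
      obtain ⟨m, rfl⟩ := Nat.not_odd_iff_even.mp hodd
      omega
    have h := hg.trans (egirth_le_card_add_one hAC hA (by omega) fun v => hδ2.trans (hδ v))
    have h' : g ≤ A.card + 1 := by exact_mod_cast h
    omega

end Separation

end SimpleGraph

/-! ### Combining the bounds on the two sides of the cut. -/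

/-- Both `x` and `y` lie in `[m, M]`. Bound `f` by its chord there; as `x + y = m + M`, the weights
at each endpoint add up to 1. -/
theorem ConvexOn.map_add_map_le_of_add_eq {s : Set ℝ} {f : ℝ → ℝ} (hf : ConvexOn ℝ s f)
    {m M x y : ℝ} (hm : m ∈ s) (hM : M ∈ s) (hx : m ≤ x) (hy : m ≤ y) (hxy : x + y = m + M) :
    f x + f y ≤ f m + f M := by
  rcases eq_or_lt_of_le (show m ≤ M by linarith) with h | h
  · obtain rfl : x = m := by linarith
    obtain rfl : y = M := by linarith
    exact le_rfl
  · have hpos : 0 < M - m := by linarith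
    have key : ∀ z w, m ≤ z → m ≤ w → z + w = m + M →
        f z ≤ (w - m) / (M - m) * f m + (z - m) / (M - m) * f M := by
      intro z w hz hw hzw
      have h1 := hf.2 hm hM
        (div_nonneg (by linarith) hpos.le : 0 ≤ (w - m) / (M - m))
        (div_nonneg (by linarith) hpos.le : 0 ≤ (z - m) / (M - m))
        (by rw [← add_div, div_eq_one_iff_eq hpos.ne']; linarith)
      simp only [smul_eq_mul] at h1
      have hz' : (w - m) / (M - m) * m + (z - m) / (M - m) * M = z := by
        obtain rfl : w = m + M - z := by linarith
        field_simp
        ring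
      rwa [hz'] at h1
    have hx' := key x y hx hy hxy
    have hy' := key y x hy hx (by linarith)
    have hsum : (y - m) / (M - m) + (x - m) / (M - m) = 1 := by
      rw [← add_div, div_eq_one_iff_eq hpos.ne']
      linarith
    calc f x + f y ≤ ((y - m) / (M - m) + (x - m) / (M - m)) * f m +
          ((y - m) / (M - m) + (x - m) / (M - m)) * f M := by linarith
      _ = f m + f M := by rw [hsum, one_mul, one_mul]

namespace SimpleGraph

theorem card_edgeFinset_le_card_edgeFinset_induce_add {V : Type*} [Fintype V] [DecidableEq V]
    (G : SimpleGraph V) [DecidableRel G.Adj] (S T : Finset V)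
    (h : ∀ a b, G.Adj a b → (a ∈ S ∧ b ∈ S) ∨ (a ∈ T ∧ b ∈ T)) :
    G.edgeFinset.card ≤
      (G.induce (S : Set V)).edgeFinset.card + (G.induce (T : Set V)).edgeFinset.card := by
  classical
  rw [← card_edgeFinset_map (Function.Embedding.subtype _) (G.induce (S : Set V)),
    ← card_edgeFinset_map (Function.Embedding.subtype _) (G.induce (T : Set V))]
  refine le_trans (Finset.card_le_card ?_) (Finset.card_union_le _ _)
  intro e
  induction e with
  | _ a b =>
  rw [mem_edgeFinset, mem_edgeSet, Finset.mem_union, mem_edgeFinset, mem_edgeSet, mem_edgeFinset,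
    mem_edgeSet]
  intro hab
  rcases h a b hab with ⟨ha, hb⟩ | ⟨ha, hb⟩
  · exact Or.inl ⟨hab.ne, ⟨a, ha⟩, ⟨b, hb⟩, hab, rfl, rfl⟩
  · exact Or.inr ⟨hab.ne, ⟨a, ha⟩, ⟨b, hb⟩, hab, rfl, rfl⟩

/-- If deleting `C` disconnects `G`, the remaining vertices split into two nonempty parts
without edges between them. -/
theorem exists_separation_of_not_preconnected {V : Type*} [Fintype V] [DecidableEq V]
    {G : SimpleGraph V} {C : Finset V} (h : ¬ (G.induce {v : V | v ∉ C}).Preconnected) :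
    ∃ A B : Finset V, A.Nonempty ∧ B.Nonempty ∧ Disjoint A B ∧ Disjoint A C ∧ Disjoint B C ∧
      A ∪ B ∪ C = univ ∧ (∀ a ∈ A, ∀ b, G.Adj a b → b ∈ A ∨ b ∈ C) ∧
      ∀ a ∈ B, ∀ b, G.Adj a b → b ∈ B ∨ b ∈ C := by
  classical
  rw [Preconnected] at h
  push Not at h
  obtain ⟨x, y, hxy⟩ := h
  let R : V → Prop := fun v => ∃ hv : v ∉ C, (G.induce {v : V | v ∉ C}).Reachable x ⟨v, hv⟩
  have hR : ∀ a b, R a → G.Adj a b → b ∉ C → R b := by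
    rintro a b ⟨ha, hxa⟩ hab hb
    exact ⟨hb, hxa.trans (Adj.reachable (show G.Adj a b from hab))⟩
  refine ⟨univ.filter R, univ.filter fun v => ¬ R v ∧ v ∉ C, ⟨x, ?_⟩, ⟨y, ?_⟩, ?_, ?_, ?_, ?_,
    ?_, ?_⟩
  · rw [Finset.mem_filter]
    exact ⟨Finset.mem_univ _, x.2, Reachable.refl _⟩
  · rw [Finset.mem_filter]
    exact ⟨Finset.mem_univ _, fun ⟨_, hy⟩ => hxy hy, y.2⟩
  · rw [Finset.disjoint_left]
    intro v hv hv'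
    exact (Finset.mem_filter.mp hv').2.1 (Finset.mem_filter.mp hv).2
  · rw [Finset.disjoint_left]
    intro v hv
    exact (Finset.mem_filter.mp hv).2.1
  · rw [Finset.disjoint_left]
    intro v hv
    exact (Finset.mem_filter.mp hv).2.2
  · ext v
    simp only [Finset.mem_union, Finset.mem_filter, Finset.mem_univ, true_and, iff_true]
    tauto
  · intro a ha b hab
    simp only [Finset.mem_filter, Finset.mem_univ, true_and] at ha ⊢
    by_cases hb : b ∈ C
    · exact Or.inr hb
    · exact Or.inl (hR a b ha hab hb)
  · intro a ha b hab
    simp only [Finset.mem_filter, Finset.mem_univ, true_and] at ha ⊢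
    by_cases hb : b ∈ C
    · exact Or.inr hb
    · exact Or.inl ⟨fun hRb => ha.1 (hR b a hRb hab.symm ha.2), hb⟩

/-- A vertex cut with fewer than `k` vertices, where `k` is at most the minimum degree,
disconnects the graph. -/
theorem exists_not_preconnected_of_not_isKConnected {V : Type*} [Fintype V] [Nonempty V]
    {G : SimpleGraph V} [DecidableRel G.Adj] {k : ℕ} (hk : ∀ v, k ≤ G.degree v)
    (h : ¬ G.IsKConnected k) :
    ∃ C : Finset V, C.card < k ∧ ¬ (G.induce {v : V | v ∉ C}).Preconnected := by
  classical
  rw [IsKConnected, not_le, vertexConnectivity] at h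
  -- Nonemptiness makes the infimum attained; all vertices but one form a vertex-cut.
  have hne : {c : ℕ | ∃ C : Finset V, G.IsVertexCut C ∧ C.card = c}.Nonempty := by
    obtain ⟨v⟩ := ‹Nonempty V›
    refine ⟨_, univ.erase v, Or.inr ?_, rfl⟩
    rw [Nat.card_eq_fintype_card, Fintype.card_eq_one_iff]
    exact ⟨⟨v, by simp⟩, fun w => Subtype.ext (by simpa using w.2)⟩
  obtain ⟨C, hC, hcard⟩ := Nat.sInf_mem hne
  rw [← hcard] at h
  -- A single remaining vertex would mean `|C| = n - 1`, but `|C| < k ≤ deg v ≤ n - 1`.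
  refine ⟨C, h, hC.resolve_right fun h1 => ?_⟩
  have h2 : Nat.card {v : V | v ∉ C} = Fintype.card V - C.card := by
    rw [← Finset.card_compl, Nat.card_eq_fintype_card, ← Set.toFinset_card]
    congr 1
    ext v
    simp
  obtain ⟨v⟩ := ‹Nonempty V›
  have h3 := G.degree_lt_card_verts v
  have h4 := hk v
  omega

theorem four_mul_card_edgeFinset_compl {V : Type*} [Fintype V] [DecidableEq V]
    (G : SimpleGraph V) [DecidableRel G.Adj] :
    (4 * Gᶜ.edgeFinset.card : ℝ) =
      2 * (Fintype.card V * (Fintype.card V - 1)) - 4 * G.edgeFinset.card := by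
  have h1 : ∑ v, (G.degree v : ℝ) = 2 * G.edgeFinset.card := by
    exact_mod_cast G.sum_degrees_eq_twice_card_edges
  have h2 : ∑ v, (Gᶜ.degree v : ℝ) = 2 * Gᶜ.edgeFinset.card := by
    exact_mod_cast Gᶜ.sum_degrees_eq_twice_card_edges
  have h3 : ∀ v, (Gᶜ.degree v : ℝ) = (Fintype.card V - 1) - G.degree v := by
    intro v
    have h4 := G.degree_lt_card_verts v
    rw [degree_compl, Nat.cast_sub (by omega), Nat.cast_sub (by omega), Nat.cast_one]
  rw [Finset.sum_congr rfl fun v _ => h3 v, Finset.sum_sub_distrib, Finset.sum_const,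
    Finset.card_univ, nsmul_eq_mul, h1] at h2
  linarith

theorem two_mul_card_edgeFinset_induce_lt {V : Type*} [Fintype V] [DecidableEq V]
    (G : SimpleGraph V) [DecidableRel G.Adj] {c t : ℕ} (hc : c = 1 ∨ c = 2) (ht : 1 ≤ t)
    (hg : ((2 * t + c : ℕ) : ℕ∞) ≤ G.egirth) {S : Finset V} (hS : S.Nonempty) :
    (2 * (G.induce (S : Set V)).edgeFinset.card : ℝ) <
      (S.card : ℝ) ^ (1 + 1 / t : ℝ) / (c : ℝ) ^ (1 / t : ℝ) + S.card := by
  have hc0 : (0 : ℝ) < c := by rcases hc with rfl | rfl <;> norm_num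
  have : Nonempty (S : Set V) := hS.to_subtype
  have h1 := two_mul_card_edgeFinset_lt (G.induce (S : Set V)) hc ht
    (hg.trans (egirth_le_egirth_induce _))
  rw [← Set.toFinset_card, Finset.toFinset_coe] at h1
  have hpos : (0 : ℝ) < S.card := by exact_mod_cast hS.card_pos
  rwa [Real.div_rpow hpos.le hc0.le, ← mul_div_assoc, ← Real.rpow_one_add' hpos.le
    (by positivity)] at h1

/-- The edge bound for graphs of girth at least `2 * t + c` with a vertex cut of fewer than `k`
vertices, where `k` is at most the minimum degree. -/
theorem two_mul_card_edgeFinset_lt_of_not_isKConnected {V : Type*} [Fintype V] [DecidableEq V]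
    [Nonempty V] {G : SimpleGraph V} [DecidableRel G.Adj] {δ g k t c : ℕ}
    (hδ : ∀ v, δ ≤ G.degree v) (hk : 2 ≤ k) (hkδ : k ≤ δ) (hg : (g : ℕ∞) ≤ G.egirth)
    (hg3 : 3 ≤ g) (hc : c = 1 ∨ c = 2) (ht : 1 ≤ t) (hgt : 2 * t + c ≤ g)
    (hν : 0 ≤ nuBound δ g (k - 1)) (h : ¬ G.IsKConnected k) :
    (2 * G.edgeFinset.card : ℝ) <
      ((nuBound δ g (k - 1) + k - 1 : ℝ) ^ (1 + 1 / t : ℝ) +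
        (Fintype.card V - nuBound δ g (k - 1) : ℝ) ^ (1 + 1 / t : ℝ)) / (c : ℝ) ^ (1 / t : ℝ) +
        (Fintype.card V + k - 1) := by
  obtain ⟨C, hCk, hC⟩ :=
    exists_not_preconnected_of_not_isKConnected (fun v => hkδ.trans (hδ v)) h
  obtain ⟨A, B, hA, hB, hAB, hAC, hBC, hunion, hAcl, hBcl⟩ :=
    exists_separation_of_not_preconnected hC
  have hνA := nuBound_le_card hAcl hA (κ := k - 1) (by omega) (by omega) (by omega) hδ hg hg3
  have hνB := nuBound_le_card hBcl hB (κ := k - 1) (by omega) (by omega) (by omega) hδ hg hg3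
  set ν := nuBound δ g (k - 1) with hνdef
  have hνA' : (ν : ℝ) ≤ A.card := by exact_mod_cast hνA
  have hνB' : (ν : ℝ) ≤ B.card := by exact_mod_cast hνB
  have hν' : (0 : ℝ) ≤ ν := by exact_mod_cast hν
  have hCk' : (C.card : ℝ) ≤ k - 1 := by
    rw [le_sub_iff_add_le]
    exact_mod_cast hCk
  have hn : (Fintype.card V : ℝ) = A.card + B.card + C.card := by
    rw [← Finset.card_univ, ← hunion,
      Finset.card_union_of_disjoint (Finset.disjoint_union_left.mpr ⟨hAC, hBC⟩),
      Finset.card_union_of_disjoint hAB]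
    push_cast
    ring
  have hedge := G.card_edgeFinset_le_card_edgeFinset_induce_add (A ∪ C) (B ∪ C) (by
    intro a b hab
    simp only [Finset.mem_union]
    have ha : a ∈ A ∪ B ∪ C := hunion ▸ Finset.mem_univ a
    have hb : b ∈ A ∪ B ∪ C := hunion ▸ Finset.mem_univ b
    simp only [Finset.mem_union] at ha hb
    rcases ha with (ha | ha) | ha
    · exact Or.inl ⟨Or.inl ha, hAcl a ha b hab⟩
    · exact Or.inr ⟨Or.inl ha, hBcl a ha b hab⟩
    · rcases hb with (hb | hb) | hb
      · exact Or.inl ⟨Or.inr ha, Or.inl hb⟩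
      · exact Or.inr ⟨Or.inr ha, Or.inl hb⟩
      · exact Or.inl ⟨Or.inr ha, Or.inr hb⟩)
  have hc0 : (0 : ℝ) < c := by rcases hc with rfl | rfl <;> norm_num
  have hedge' : (G.edgeFinset.card : ℝ) ≤
      (G.induce ((A ∪ C : Finset V) : Set V)).edgeFinset.card +
        (G.induce ((B ∪ C : Finset V) : Set V)).edgeFinset.card := by
    rw [← Nat.cast_add]
    exact Nat.cast_le.mpr hedge
  have hg' : ((2 * t + c : ℕ) : ℕ∞) ≤ G.egirth := le_trans (by exact_mod_cast hgt) hg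
  have hA' := G.two_mul_card_edgeFinset_induce_lt hc ht hg'
    (hA.mono (Finset.subset_union_left (s₂ := C)))
  have hB' := G.two_mul_card_edgeFinset_induce_lt hc ht hg'
    (hB.mono (Finset.subset_union_left (s₂ := C)))
  rw [Finset.card_union_of_disjoint hAC] at hA'
  rw [Finset.card_union_of_disjoint hBC] at hB'
  rw [Nat.cast_add] at hA' hB'
  have hp : (1 : ℝ) ≤ 1 + 1 / t := by
    have : (0 : ℝ) ≤ 1 / t := by positivity
    linarith
  have hCnn : (0 : ℝ) ≤ C.card := by positivity
  -- The orders `|A| + |C|` and `|B| + |C|` have the same sum as `ν + |C|` and `n - ν`, and both are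
  -- at least `ν + |C|`. Only afterwards is `|C|` replaced by `k - 1`, in the first base and in the
  -- linear term `n + |C|`.
  have hconv := (convexOn_rpow hp).map_add_map_le_of_add_eq (m := ν + C.card)
    (M := Fintype.card V - ν) (x := A.card + C.card) (y := B.card + C.card)
    (by rw [Set.mem_Ici]; linarith) (by rw [Set.mem_Ici]; linarith) (by linarith) (by linarith)
    (by linarith)
  have hmono : ((ν : ℝ) + C.card) ^ (1 + 1 / t : ℝ) ≤ (ν + k - 1 : ℝ) ^ (1 + 1 / t : ℝ) :=
    Real.rpow_le_rpow (by linarith) (by linarith) (by linarith)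
  have hcp : (0 : ℝ) < (c : ℝ) ^ (1 / t : ℝ) := Real.rpow_pos_of_pos hc0 _
  have hfrac : ((A.card : ℝ) + C.card) ^ (1 + 1 / t : ℝ) / (c : ℝ) ^ (1 / t : ℝ) +
      ((B.card : ℝ) + C.card) ^ (1 + 1 / t : ℝ) / (c : ℝ) ^ (1 / t : ℝ) ≤
      ((ν + k - 1 : ℝ) ^ (1 + 1 / t : ℝ) + (Fintype.card V - ν : ℝ) ^ (1 + 1 / t : ℝ)) /
        (c : ℝ) ^ (1 / t : ℝ) := by
    rw [← add_div]
    exact div_le_div_of_nonneg_right (by linarith) hcp.le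
  linarith

/-- The spectral condition with both parities of the girth treated at once. -/
theorem isKConnected_of_qIndex_compl_le {V : Type*} [Fintype V] [DecidableEq V]
    [Nonempty V] {G : SimpleGraph V} [DecidableRel G.Adj] {δ g k t c : ℕ}
    (hδ : ∀ v, δ ≤ G.degree v) (hk : 2 ≤ k) (hkδ : k ≤ δ) (hg : (g : ℕ∞) ≤ G.egirth)
    (hg3 : 3 ≤ g) (hc : c = 1 ∨ c = 2) (ht : 1 ≤ t) (hgt : 2 * t + c ≤ g)
    (hν : 0 ≤ nuBound δ g (k - 1))
    (hq : Gᶜ.qIndex ≤ 2 * ((Fintype.card V : ℝ) - 1)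
      - 2 / (Fintype.card V * (c : ℝ) ^ (1 / t : ℝ)) *
          (nuBound δ g (k - 1) + k - 1 : ℝ) ^ (1 + 1 / t : ℝ)
      - 2 / (Fintype.card V * (c : ℝ) ^ (1 / t : ℝ)) *
          (Fintype.card V - nuBound δ g (k - 1) : ℝ) ^ (1 + 1 / t : ℝ)
      - 2 / (Fintype.card V : ℝ) * (Fintype.card V + k - 1)) :
    G.IsKConnected k := by
  by_contra h
  have h1 := two_mul_card_edgeFinset_lt_of_not_isKConnected hδ hk hkδ hg hg3 hc ht hgt hν h
  have h2 := Gᶜ.four_mul_card_edgeFinset_div_le_qIndex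
  rw [four_mul_card_edgeFinset_compl] at h2
  have hn : (0 : ℝ) < Fintype.card V := by exact_mod_cast Fintype.card_pos
  have hcp : (0 : ℝ) < (c : ℝ) ^ (1 / t : ℝ) :=
    Real.rpow_pos_of_pos (by rcases hc with rfl | rfl <;> norm_num) _
  have h3 := h2.trans hq
  rw [div_le_iff₀ hn] at h3
  set x := (nuBound δ g (k - 1) + k - 1 : ℝ) ^ (1 + 1 / t : ℝ)
  set y := (Fintype.card V - nuBound δ g (k - 1) : ℝ) ^ (1 + 1 / t : ℝ)
  set r := (c : ℝ) ^ (1 / t : ℝ)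
  have h4 : (2 * ((Fintype.card V : ℝ) - 1) - 2 / (Fintype.card V * r) * x
      - 2 / (Fintype.card V * r) * y - 2 / (Fintype.card V : ℝ) * (Fintype.card V + k - 1)) *
      Fintype.card V = 2 * (Fintype.card V * (Fintype.card V - 1)) -
        2 * ((x + y) / r + (Fintype.card V + k - 1)) := by
    field_simp
    ring
  linarith

end SimpleGraph

/-- Nonnegativity of `ν` keeps the base `ν + |C|` in the domain where the real power is convex and
monotone. -/
theorem one_le_nuBound {δ g κ : ℕ} (hκ : κ < δ) : 1 ≤ nuBound δ g κ := by
  have h1 : (0 : ℤ) ≤ ∑ i ∈ range (girthHalf g), ((δ : ℤ) - 1) ^ i :=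
    Finset.sum_nonneg fun i _ => pow_nonneg (by omega) i
  rw [nuBound]
  split_ifs
  · have := mul_nonneg (by omega : (0 : ℤ) ≤ (δ : ℤ) - κ) h1
    omega
  · have := mul_nonneg (by omega : (0 : ℤ) ≤ 2 * (δ : ℤ) - 2 - κ) h1
    omega
  · omega

theorem theorem3p3 {V : Type*} [Fintype V] [DecidableEq V]
    (G : SimpleGraph V) [DecidableRel G.Adj] (hconn : G.Connected)
    (n δ g k t : ℕ) (ν : ℤ)
    (hn : Fintype.card V = n)
    (hδ : G.minDegree = δ) (hk : 2 ≤ k) (hkδ : k ≤ δ)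
    (hg : G.egirth = g) (hg3 : 3 ≤ g)
    (ht : t = girthHalf g)
    (hν : ν = nuBound δ g (k - 1))
    (hq : Gᶜ.qIndex ≤
      if Odd g then
        2 * ((n : ℝ) - 1)
          - 2 / (n : ℝ) * ((ν : ℝ) + k - 1) ^ (1 + 1 / (t : ℝ))
          - 2 / (n : ℝ) * ((n : ℝ) - ν) ^ (1 + 1 / (t : ℝ))
          - 2 / (n : ℝ) * ((n : ℝ) + k - 1)
      else
        2 * ((n : ℝ) - 1)
          - 2 / ((n : ℝ) * (2 : ℝ) ^ (1 / (t : ℝ))) * ((ν : ℝ) + k - 1) ^ (1 + 1 / (t : ℝ))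
          - 2 / ((n : ℝ) * (2 : ℝ) ^ (1 / (t : ℝ))) * ((n : ℝ) - ν) ^ (1 + 1 / (t : ℝ))
          - 2 / (n : ℝ) * ((n : ℝ) + k - 1)) :
    G.IsKConnected k := by
  subst hn hν ht
  have := hconn.nonempty
  have hdeg : ∀ v, δ ≤ G.degree v := fun v => hδ ▸ G.minDegree_le_degree v
  have hν := (one_le_nuBound (g := g) (show k - 1 < δ by omega)).trans' zero_le_one
  have ht : 1 ≤ girthHalf g := by
    rw [girthHalf]
    omega
  split_ifs at hq with hodd
  -- The parity of the girth fixes `c` through `g = 2t + c`; for `c = 1` the factor `c^(1/t)` is 1.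
  · refine G.isKConnected_of_qIndex_compl_le (c := 1) hdeg hk hkδ hg.ge hg3 (Or.inl rfl) ht ?_ hν ?_
    · obtain ⟨m, rfl⟩ := hodd
      rw [girthHalf]
      omega
    · simpa only [Nat.cast_one, Real.one_rpow, mul_one] using hq
  · refine G.isKConnected_of_qIndex_compl_le (c := 2) hdeg hk hkδ hg.ge hg3 (Or.inr rfl) ht ?_ hν ?_
    · obtain ⟨m, rfl⟩ := Nat.not_odd_iff_even.mp hodd
      rw [girthHalf]
      omega
    · simpa only [Nat.cast_ofNat] using hq
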